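/- An ordered group $(G,P)$ is a (discrete) group $G$ with a submonoid $P$ such that $P\cap P^{-1}=\{1\}$ (a positive cone); $G$ carries the left-invariant partial order $a\le b \iff a^{-1}b\in P$. An order homomorphism $\varphi:(G,P)\to(H,Q)$ is a group homomorphism with $\varphi(P)\subseteq Q$. It is a reduction if for every $p\in P$ it maps the interval $[1,p]$ bijectively onto $[1,\varphi(p)]$, and a strong reduction if it maps $P$ bijectively onto $Q$. We say that $(G,P)$ (strongly) reduces to an amenable ordered group if there are an amenable group $H$, a positive cone $Q\subseteq H$ and a (strong) reduction $(G,P)\to(H,Q)$. Here a discrete group $H$ is amenable if there is a left-invariant mean on $\ell^\infty(H)$ (equivalently, if the canonical map $C^*(H)\to C^*_r(H)$ is injective). A hereditary subgroup of $(G,P)$ is an ordered group $(H,Q)$ with $H$ a subgroup of $G$ and $Q\subseteq P\cap H$ such that $p_1,p_2\in P$, $p_1p_2\in Q$ imply $p_1,p_2\in Q$. For ordered groups $(G_1,P_1),(G_2,P_2)$, let $P_1*P_2\subseteq G_1*G_2$ be the submonoid of the free product generated by the copies of $P_1$ and $P_2$ (similarly for finitely many factors). Let $G_1\wr G_2=\big(\bigoplus_{G_2}G_1\big)\rtimes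 G_2$ be the restricted wreath product, where $G_2$ acts by left translation, and let $P_1\wr P_2$ be its submonoid generated by the copies of $P_1$ (at the coordinate $1$) and $P_2$. Theorem. Each of the two classes of ordered groups, those that reduce to an amenable ordered group and those that strongly reduce to an amenable ordered group, has the following properties. 1. It contains every ordered group $(G,P)$ with $G$ amenable. 2. It is closed under hereditary subgroups. 3. It is closed under finite direct products $(\prod_i G_i,\prod_i P_i)$. 4. It is closed under finite free products $(*_i G_i, *_i P_i)$. In particular, all these products are again ordered groups. Moreover, for all ordered groups $(G_1,P_1)$ and $(G_2,P_2)$, $P_1\wr P_2$ is a positive cone in $G_1\wr G_2$, the natural homomorphism $G_1*G_2\to G_1\wr G_2$ is surjective and is a strong reduction $(G_1*G_2,P_1*P_2)\to(G_1\wr G_2,P_1\wr P_2)$, and $G_1\wr G_2$ is amenable if $G_1$ and $G_2$ are. If $\varphi_i:(G_i,P_i)\to(H_i,Q_i)$ ($i=1,2$) are (strong) reductions of ordered groups, then the composite $G_1*G_2\xrightarrow{\varphi_1*\varphi_2}H_1*H_2\to H_1\wr H_2$ is a (strong) reduction $(G_1*G_2,P_1*P_2)\to(H_1\wr H_2,Q_1\wr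 Q_2)$. -/

import Mathlib

/-! An ordered group `(G, P)` is a group `G` with a positive cone `P`; the order on `G` is the
left-invariant partial order `a ≤ b ↔ a⁻¹ * b ∈ P`. All groups are discrete. -/

universe u

/-- A submonoid `P` of a group is a positive cone if `P ∩ P⁻¹ = {1}`. -/
def IsPositiveCone {G : Type*} [Group G] (P : Submonoid G) : Prop :=
  ∀ x : G, x ∈ P → x⁻¹ ∈ P → x = 1

/-- The relation `a ≤ b` defined by `P`. -/
def ConeLE {G : Type*} [Group G] (P : Submonoid G) (a b : G) : Prop :=
  a⁻¹ * b ∈ P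

/-- The interval `[a, b]` for the order defined by `P`. -/
def coneIcc {G : Type*} [Group G] (P : Submonoid G) (a b : G) : Set G :=
  {g | ConeLE P a g ∧ ConeLE P g b}

/-- A group homomorphism `φ` is an order homomorphism `(G, P) → (H, Q)` if `φ(P) ⊆ Q`. -/
def IsOrderHom {G H : Type*} [Group G] [Group H] (P : Submonoid G) (Q : Submonoid H)
    (φ : G →* H) : Prop :=
  ∀ p ∈ P, φ p ∈ Q

/-- A reduction: an order homomorphism that restricts to a bijection `[1, p] → [1, φ p]` for
every `p ∈ P`. -/
def IsReduction {G H : Type*} [Group G] [Group H] (P : Submonoid G) (Q : Submonoid H)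
    (φ : G →* H) : Prop :=
  IsOrderHom P Q φ ∧ ∀ p ∈ P, Set.BijOn φ (coneIcc P 1 p) (coneIcc Q 1 (φ p))

/-- A strong reduction: an order homomorphism that restricts to a bijection `P → Q`. -/
def IsStrongReduction {G H : Type*} [Group G] [Group H] (P : Submonoid G) (Q : Submonoid H)
    (φ : G →* H) : Prop :=
  IsOrderHom P Q φ ∧ Set.BijOn φ (P : Set G) (Q : Set H)

/-- A (discrete) group is amenable if there is a left-invariant mean on `ℓ^∞(G)`: a positive
linear functional of value `1` at the constant function `1`, invariant under left translation. -/
def IsAmenable (G : Type*) [Group G] : Prop :=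
  ∃ m : lp (fun _ : G => ℝ) ⊤ →ₗ[ℝ] ℝ,
    (∀ f : lp (fun _ : G => ℝ) ⊤, (∀ x, f x = 1) → m f = 1) ∧
    (∀ f : lp (fun _ : G => ℝ) ⊤, (∀ x, 0 ≤ f x) → 0 ≤ m f) ∧
    ∀ (g : G) (f f' : lp (fun _ : G => ℝ) ⊤), (∀ x, f' x = f (g⁻¹ * x)) → m f' = m f

/-- `(G, P)` reduces to an amenable ordered group `(H, Q)`. Taking `H` in the universe of `G` is
no restriction, since `(H, Q)` can be replaced by `(φ(G), φ(P))`. -/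
def ReducesToAmenable {G : Type u} [Group G] (P : Submonoid G) : Prop :=
  ∃ (H : Type u) (_ : Group H) (Q : Submonoid H) (φ : G →* H),
    IsAmenable H ∧ IsPositiveCone Q ∧ IsReduction P Q φ

/-- `(G, P)` strongly reduces to an amenable ordered group `(H, Q)`. -/
def StronglyReducesToAmenable {G : Type u} [Group G] (P : Submonoid G) : Prop :=
  ∃ (H : Type u) (_ : Group H) (Q : Submonoid H) (φ : G →* H),
    IsAmenable H ∧ IsPositiveCone Q ∧ IsStrongReduction P Q φ

/-- `(H, Q)` is a hereditary subgroup of `(G, P)`: `H` is a subgroup of `G`, `Q ⊆ P ∩ H`, and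
`p₁ * p₂ ∈ Q` with `p₁, p₂ ∈ P` implies `p₁, p₂ ∈ Q`. The cone `Q` is given as a submonoid of the
group `H`. -/
def IsHereditarySubgroup {G : Type*} [Group G] (P : Submonoid G) (H : Subgroup G)
    (Q : Submonoid H) : Prop :=
  Q.map H.subtype ≤ P ∧
    ∀ p₁ ∈ P, ∀ p₂ ∈ P, p₁ * p₂ ∈ Q.map H.subtype →
      p₁ ∈ Q.map H.subtype ∧ p₂ ∈ Q.map H.subtype

/-- `P * Q`: the submonoid of the free product `G * H` generated by the copies of `P` and `Q`. -/
def freeProductCone {G H : Type*} [Group G] [Group H] (P : Submonoid G) (Q : Submonoid H) :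
    Submonoid (Monoid.Coprod G H) :=
  P.map Monoid.Coprod.inl ⊔ Q.map Monoid.Coprod.inr

/-- The submonoid of the free product of a family of groups generated by the copies of the
given submonoids. -/
def freeProductConeI {ι : Type*} {G : ι → Type*} [∀ i, Group (G i)]
    (P : ∀ i, Submonoid (G i)) : Submonoid (Monoid.CoprodI G) :=
  ⨆ i, (P i).map Monoid.CoprodI.of

/-- The restricted wreath product `G ≀ H`, as the subgroup of the unrestricted one formed by the
pairs `(f, h)` with `f : H → G` of finite support. The product is
`(f₁, h₁) (f₂, h₂) = (f₁ · f₂(h₁⁻¹ ·), h₁ h₂)`. -/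
def restrictedWreath (G H : Type*) [Group G] [Group H] : Subgroup (RegularWreathProduct G H) where
  carrier := {x | (Function.mulSupport x.left).Finite}
  one_mem' := by simp
  mul_mem' := by
    intro a b ha hb
    have hb' : (Function.mulSupport fun x => b.left (a.right⁻¹ * x)).Finite :=
      Set.Finite.preimage (mul_right_injective (a.right⁻¹)).injOn hb
    exact (Set.Finite.union ha hb').subset (Function.mulSupport_mul _ _)
  inv_mem' := by
    intro a ha
    refine (Set.Finite.preimage (mul_right_injective a.right).injOn ha).subset ?_
    intro x hx
    simpa using hx

open Classical in
/-- The embedding `g ↦ (g δ₁, 1)` of `G` into `G ≀ H`. -/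
noncomputable def wreathLeft (G H : Type*) [Group G] [Group H] : G →* restrictedWreath G H where
  toFun g := ⟨⟨Pi.mulSingle 1 g, 1⟩, by
    refine (Set.finite_singleton (1 : H)).subset ?_
    exact Pi.mulSupport_mulSingle_subset⟩
  map_one' := by
    ext <;> simp
  map_mul' a b := by
    ext <;> simp [Pi.mulSingle_mul]

/-- The embedding `h ↦ (1, h)` of `H` into `G ≀ H`. -/
def wreathRight (G H : Type*) [Group G] [Group H] : H →* restrictedWreath G H where
  toFun h := ⟨⟨1, h⟩, by simp [restrictedWreath]⟩
  map_one' := by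
    ext <;> simp
  map_mul' a b := by
    ext <;> simp

/-- `P ≀ Q`: the submonoid of `G ≀ H` generated by the copies of `P` and `Q`. -/
noncomputable def wreathCone {G H : Type*} [Group G] [Group H]
    (P : Submonoid G) (Q : Submonoid H) : Submonoid (restrictedWreath G H) :=
  P.map (wreathLeft G H) ⊔ Q.map (wreathRight G H)

/-- The natural homomorphism `G * H → G ≀ H`. -/
noncomputable def freeToWreath (G H : Type*) [Group G] [Group H] :
    Monoid.Coprod G H →* restrictedWreath G H :=
  Monoid.Coprod.lift (wreathLeft G H) (wreathRight G H)

/-! Every element of `P * Q` is spelled by a unique reduced word with letters in `P` and `Q`, and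
this word can be recovered from its image in the wreath product: for a reduced word `x * y * w` with
`x ∈ P` and `y ∈ Q`, the base coordinate at `1` of the image is `x`. If `w` is not empty, the image
of `y * w` has its base coordinates supported in `y * Q` and nontrivial at `y`, so that `y` is the
least element of the support. Hence `G * H → G ≀ H` is injective on `P * Q`. The interval from `1`
to a reduced word consists of the initial parts of the word, so that reductions of the factors,
which act letter by letter, induce a reduction of the free product.

Amenability of `G ≀ H` follows from that of extensions and of directed unions: averaging means over
the cosets of a normal subgroup gives an invariant mean on an extension, and the limit of means
along an ultrafilter gives one on a directed union, such as a direct sum. -/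

section Mean

variable {X Y Z : Type*}

/-- A mean on `X`: a positive linear functional on `ℓ^∞(X)` of value `1` at the constant function
`1`. -/
structure Mean (X : Type*) where
  toLinearMap : lp (fun _ : X => ℝ) ⊤ →ₗ[ℝ] ℝ
  map_one : toLinearMap 1 = 1
  nonneg : ∀ f, (∀ x, 0 ≤ f x) → 0 ≤ toLinearMap f

namespace Mean

noncomputable instance : CoeFun (Mean X) fun _ => lp (fun _ : X => ℝ) ⊤ → ℝ :=
  ⟨fun m => m.toLinearMap⟩

@[ext]
theorem ext {m m' : Mean X} (h : ∀ f, m f = m' f) : m = m' := by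
  obtain ⟨m, _, _⟩ := m
  obtain ⟨m', _, _⟩ := m'
  obtain rfl : m = m' := LinearMap.ext h
  rfl

theorem abs_apply_le_norm (m : Mean X) (f : lp (fun _ : X => ℝ) ⊤) : |m f| ≤ ‖f‖ := by
  have hf (x : X) : |f x| ≤ ‖f‖ := lp.norm_apply_le_norm (by simp) f x
  have hle : 0 ≤ m (‖f‖ • 1 - f) := m.nonneg _ fun x =>
    show 0 ≤ ‖f‖ * 1 - f x by linarith [(abs_le.1 (hf x)).2]
  have hge : 0 ≤ m (f + ‖f‖ • 1) := m.nonneg _ fun x =>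
    show 0 ≤ f x + ‖f‖ * 1 by linarith [(abs_le.1 (hf x)).1]
  simp only [map_sub, map_add, map_smul, m.map_one, smul_eq_mul, mul_one] at hle hge
  exact abs_le.2 ⟨by linarith, by linarith⟩

/-- The functions `x ↦ N x f`, for a family `N` of means: the integrand of `Mean.bind`. -/
noncomputable def evalFamily (N : X → Mean Y) :
    lp (fun _ : Y => ℝ) ⊤ →ₗ[ℝ] lp (fun _ : X => ℝ) ⊤ where
  toFun f :=
    ⟨fun x => N x f, memℓp_infty ⟨‖f‖, Set.forall_mem_range.2 fun x => (N x).abs_apply_le_norm f⟩⟩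
  map_add' f g := lp.ext (funext fun x => map_add (N x).toLinearMap f g)
  map_smul' c f := lp.ext (funext fun x => map_smul (N x).toLinearMap c f)

/-- The evaluation of bounded functions at a point. -/
noncomputable def dirac (x : X) : Mean X where
  toLinearMap :=
    { toFun := fun f => f x
      map_add' := fun _ _ => rfl
      map_smul' := fun _ _ => rfl }
  map_one := rfl
  nonneg _ h := h x

/-- The average of a family `N` of means with respect to a mean `m` on the index set. -/
noncomputable def bind (m : Mean X) (N : X → Mean Y) : Mean Y where
  toLinearMap := m.toLinearMap ∘ₗ evalFamily N
  map_one := (congrArg m (lp.ext (funext fun x => (N x).map_one))).trans m.map_one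
  nonneg f hf := m.nonneg _ fun x => (N x).nonneg f hf

/-- The push-forward of a mean. -/
noncomputable def map (k : X → Y) (m : Mean X) : Mean Y :=
  m.bind fun x => dirac (k x)

theorem map_bind (m : Mean X) (N : X → Mean Y) (k : Y → Z) :
    (m.bind N).map k = m.bind fun x => (N x).map k :=
  rfl

theorem bind_map (m : Mean X) (k : X → Y) (N : Y → Mean Z) :
    (m.map k).bind N = m.bind fun x => N (k x) :=
  rfl

theorem map_map (m : Mean X) (k : X → Y) (l : Y → Z) : (m.map k).map l = m.map (l ∘ k) :=
  rfl

open Filter Topology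

theorem tendsto_limUnder (U : Ultrafilter X) (f : lp (fun _ : X => ℝ) ⊤) :
    Tendsto f U (𝓝 (limUnder (U : Filter X) f)) := by
  have hf (x : X) : f x ∈ Set.Icc (-‖f‖) ‖f‖ := abs_le.1 (lp.norm_apply_le_norm (by simp) f x)
  obtain ⟨a, -, ha⟩ := isCompact_Icc.ultrafilter_le_nhds (U.map f)
    (tendsto_principal.2 (Eventually.of_forall hf))
  exact tendsto_nhds_limUnder ⟨a, ha⟩

/-- The limit of bounded functions along an ultrafilter. -/
noncomputable def ofUltrafilter (U : Ultrafilter X) : Mean X where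
  toLinearMap :=
    { toFun := fun f => limUnder (U : Filter X) f
      map_add' := fun f g => ((tendsto_limUnder U f).add (tendsto_limUnder U g)).limUnder_eq
      map_smul' := fun c f => ((tendsto_limUnder U f).const_mul c).limUnder_eq }
  map_one := tendsto_const_nhds.limUnder_eq
  nonneg f hf := ge_of_tendsto' (tendsto_limUnder U f) hf

theorem bind_ofUltrafilter_congr {U : Ultrafilter X} {N N' : X → Mean Y}
    (h : ∀ᶠ x in U, N x = N' x) : (ofUltrafilter U).bind N = (ofUltrafilter U).bind N' := by
  ext f
  refine ((tendsto_limUnder U (evalFamily N' f)).congr' ?_).limUnder_eq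
  filter_upwards [h] with x hx
  exact congrArg (fun m : Mean Y => m f) hx.symm

end Mean

end Mean

theorem isAmenable_iff_exists_mean {G : Type*} [Group G] :
    IsAmenable G ↔ ∃ m : Mean G, ∀ g, m.map (g * ·) = m := by
  constructor
  · rintro ⟨m, hone, hnonneg, hinv⟩
    exact ⟨⟨m, hone 1 fun _ => rfl, hnonneg⟩, fun g => Mean.ext fun f =>
      hinv g⁻¹ f _ fun x => by rw [inv_inv]; rfl⟩
  · rintro ⟨m, hinv⟩
    refine ⟨m.toLinearMap, fun f hf => ?_, m.nonneg, fun g f f' hf => ?_⟩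
    · obtain rfl : f = 1 := lp.ext (funext hf)
      exact m.map_one
    · obtain rfl : f' = Mean.evalFamily (fun x => .dirac (g⁻¹ * x)) f := lp.ext (funext hf)
      exact congrArg (fun m : Mean G => m f) (hinv g⁻¹)

namespace IsAmenable

variable {G H : Type*} [Group G] [Group H]

theorem of_surjective (hG : IsAmenable G) (φ : G →* H) (hφ : Function.Surjective φ) :
    IsAmenable H := by
  obtain ⟨m, hm⟩ := isAmenable_iff_exists_mean.1 hG
  refine isAmenable_iff_exists_mean.2 ⟨m.map φ, hφ.forall.2 fun g => ?_⟩
  calc (m.map φ).map (φ g * ·) = (m.map (g * ·)).map φ := by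
        simp only [Mean.map_map, Function.comp_def, map_mul]
    _ = m.map φ := by rw [hm g]

theorem of_subsingleton [Subsingleton G] : IsAmenable G :=
  isAmenable_iff_exists_mean.2 ⟨.dirac 1, fun _ => congrArg Mean.dirac (Subsingleton.elim _ _)⟩

theorem of_extension {N : Type*} [Group N] (hN : IsAmenable N) (hH : IsAmenable H) (j : N →* G)
    (π : G →* H) (hπ : Function.Surjective π) (hker : π.ker ≤ j.range) : IsAmenable G := by
  obtain ⟨n, hn⟩ := isAmenable_iff_exists_mean.1 hN
  obtain ⟨m, hm⟩ := isAmenable_iff_exists_mean.1 hH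
  have coset_mean_eq (g g' : G) (h : π g = π g') : n.map (g * j ·) = n.map (g' * j ·) := by
    obtain ⟨k, hk⟩ := hker (show g⁻¹ * g' ∈ π.ker by simp [MonoidHom.mem_ker, h])
    calc n.map (g * j ·) = (n.map (k * ·)).map (g * j ·) := by rw [hn k]
      _ = n.map (g' * j ·) := by
        simp only [Mean.map_map, Function.comp_def, map_mul, hk, ← mul_assoc, mul_inv_cancel,
          one_mul]
  obtain ⟨s, hs⟩ := hπ.hasRightInverse
  refine isAmenable_iff_exists_mean.2 ⟨m.bind fun h => n.map (s h * j ·), fun g => ?_⟩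
  calc (m.bind fun h => n.map (s h * j ·)).map (g * ·)
      = m.bind fun h => n.map (g * s h * j ·) := by
        simp only [Mean.map_bind, Mean.map_map, Function.comp_def, mul_assoc]
    _ = m.bind fun h => n.map (s (π g * h) * j ·) := by
        congr! 2 with h
        exact coset_mean_eq _ _ (by rw [map_mul, hs, hs])
    _ = (m.map (π g * ·)).bind fun h => n.map (s h * j ·) := (Mean.bind_map _ _ _).symm
    _ = m.bind fun h => n.map (s h * j ·) := by rw [hm]

theorem prod (hG : IsAmenable G) (hH : IsAmenable H) : IsAmenable (G × H) :=
  hG.of_extension hH (MonoidHom.inl G H) (MonoidHom.snd G H) Prod.snd_surjective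
    fun x hx => ⟨x.1, Prod.ext rfl (MonoidHom.mem_ker.1 hx).symm⟩

theorem of_directed {ι : Type*} [Preorder ι] [Nonempty ι] [IsDirectedOrder ι] {N : ι → Type*}
    [∀ i, Group (N i)] (hN : ∀ i, IsAmenable (N i)) (j : ∀ i, N i →* G)
    (hj : ∀ g, ∀ᶠ i in Filter.atTop, g ∈ (j i).range) : IsAmenable G := by
  choose n hn using fun i => isAmenable_iff_exists_mean.1 (hN i)
  let U : Ultrafilter ι := .of Filter.atTop
  refine isAmenable_iff_exists_mean.2
    ⟨(Mean.ofUltrafilter U).bind fun i => (n i).map (j i), fun g => ?_⟩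
  rw [Mean.map_bind]
  refine Mean.bind_ofUltrafilter_congr (Ultrafilter.of_le _ ((hj g).mono ?_))
  rintro i ⟨k, rfl⟩
  calc ((n i).map (j i)).map (j i k * ·) = ((n i).map (k * ·)).map (j i) := by
        simp only [Mean.map_map, Function.comp_def, map_mul]
    _ = (n i).map (j i) := by rw [hn]

end IsAmenable

/-- The direct sum of a family of groups, as the subgroup of the families in `∏ G i` with finitely
many nontrivial entries. -/
def finitelySupported {ι : Type*} (G : ι → Type*) [∀ i, Group (G i)] : Subgroup (∀ i, G i) where
  carrier := {f | {i | f i ≠ 1}.Finite}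
  one_mem' := by simp
  mul_mem' {f f'} hf hf' := (hf.union hf').subset fun i hi => by
    by_contra! h
    simp_all
  inv_mem' {f} hf := by simpa using hf

theorem mulSingle_mem_finitelySupported {ι : Type*} {G : ι → Type*} [∀ i, Group (G i)]
    [DecidableEq ι] (i : ι) (g : G i) : Pi.mulSingle i g ∈ finitelySupported G :=
  (Set.finite_singleton i).subset fun _ hj => by_contra fun hne => hj (Pi.mulSingle_eq_of_ne hne g)

namespace IsAmenable

variable {ι : Type*} {G : ι → Type*} [∀ i, Group (G i)]

theorem subgroupPi_compl_bot (hG : ∀ i, IsAmenable (G i)) {s : Set ι} (hs : s.Finite) :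
    IsAmenable (Subgroup.pi sᶜ fun i => (⊥ : Subgroup (G i))) := by
  classical
  induction s, hs using Set.Finite.induction_on with
  | empty =>
    have : Subsingleton (Subgroup.pi (∅ : Set ι)ᶜ fun i => (⊥ : Subgroup (G i))) :=
      subsingleton_of_forall_eq 1 fun f => Subtype.ext (funext fun i => f.2 i (by simp))
    exact .of_subsingleton
  | @insert a s _ _ ih =>
    have hle : (Subgroup.pi sᶜ fun i => (⊥ : Subgroup (G i))) ≤
        Subgroup.pi (insert a s)ᶜ fun _ => ⊥ :=
      fun f hf i hi => hf i (mt (Set.mem_insert_of_mem a) hi)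
    refine ih.of_extension (hG a) (Subgroup.inclusion hle)
      ((Pi.evalMonoidHom G a).comp (Subgroup.subtype _)) (fun g => ?_) fun f hf => ?_
    · refine ⟨⟨Pi.mulSingle a g, fun i hi => ?_⟩, Pi.mulSingle_eq_same a g⟩
      exact Pi.mulSingle_eq_of_ne (ne_of_mem_of_not_mem (Set.mem_insert a s) hi).symm g
    · refine ⟨⟨f, fun i hi => ?_⟩, rfl⟩
      obtain rfl | hia := eq_or_ne i a
      · exact hf
      · exact f.2 i (by simp_all)

theorem finitelySupported (hG : ∀ i, IsAmenable (G i)) : IsAmenable (finitelySupported G) := by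
  have hle (s : Finset ι) :
      (Subgroup.pi (s : Set ι)ᶜ fun i => (⊥ : Subgroup (G i))) ≤ _root_.finitelySupported G :=
    fun f hf => s.finite_toSet.subset fun i hi => by_contra fun his => hi (hf i his)
  refine of_directed (fun s : Finset ι => subgroupPi_compl_bot hG s.finite_toSet)
    (fun s => Subgroup.inclusion (hle s)) fun f => ?_
  filter_upwards [Filter.eventually_ge_atTop (Set.Finite.toFinset f.2)] with s hs
  exact ⟨⟨f, fun i hi => by_contra fun hne => hi (hs ((Set.Finite.mem_toFinset f.2).2 hne))⟩, rfl⟩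

theorem pi [Finite ι] (hG : ∀ i, IsAmenable (G i)) : IsAmenable (∀ i, G i) :=
  (finitelySupported hG).of_surjective (Subgroup.subtype _) fun f => ⟨⟨f, Set.toFinite _⟩, rfl⟩

end IsAmenable

section Wreath

variable {G H : Type*} [Group G] [Group H]

namespace restrictedWreath

/-- The projection of `G ≀ H` onto `H`. -/
def rightHom (G H : Type*) [Group G] [Group H] : restrictedWreath G H →* H :=
  RegularWreathProduct.rightHom.comp (Subgroup.subtype _)

/-- The inclusion of the base group `⨁_H G` into `G ≀ H`. -/
def baseHom (G H : Type*) [Group G] [Group H] :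
    finitelySupported (fun _ : H => G) →* restrictedWreath G H where
  toFun f := ⟨⟨f, 1⟩, f.2⟩
  map_one' := rfl
  map_mul' f f' := by ext <;> simp

theorem ker_rightHom_le_range_baseHom : (rightHom G H).ker ≤ (baseHom G H).range :=
  fun x hx => ⟨⟨x.1.left, x.2⟩, Subtype.ext (RegularWreathProduct.ext rfl hx.symm)⟩

end restrictedWreath

theorem IsAmenable.restrictedWreath (hG : IsAmenable G) (hH : IsAmenable H) :
    IsAmenable (restrictedWreath G H) :=
  (IsAmenable.finitelySupported fun _ => hG).of_extension hH (restrictedWreath.baseHom G H)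
    (restrictedWreath.rightHom G H) (fun h => ⟨wreathRight G H h, rfl⟩)
    restrictedWreath.ker_rightHom_le_range_baseHom

@[simp]
theorem freeToWreath_inl (g : G) : freeToWreath G H (.inl g) = wreathLeft G H g :=
  Monoid.Coprod.lift_apply_inl _ _ g

@[simp]
theorem freeToWreath_inr (h : H) : freeToWreath G H (.inr h) = wreathRight G H h :=
  Monoid.Coprod.lift_apply_inr _ _ h

theorem wreathRight_mul_left (h : H) (w : restrictedWreath G H) (c : H) :
    (wreathRight G H h * w).1.left c = w.1.left (h⁻¹ * c) := by
  simp [wreathRight]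

theorem wreathLeft_mul_left_one (g : G) (w : restrictedWreath G H) :
    (wreathLeft G H g * w).1.left 1 = g * w.1.left 1 := by
  simp [wreathLeft]

theorem wreathLeft_mul_left_of_ne (g : G) (w : restrictedWreath G H) {c : H} (hc : c ≠ 1) :
    (wreathLeft G H g * w).1.left c = w.1.left c := by
  simp [wreathLeft, hc]

theorem restrictedWreath.baseHom_mulSingle [DecidableEq H] (h : H) (g : G) :
    baseHom G H ⟨Pi.mulSingle h g, mulSingle_mem_finitelySupported (G := fun _ => G) h g⟩ =
      wreathRight G H h * wreathLeft G H g * (wreathRight G H h)⁻¹ := by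
  ext
  · simp [baseHom, wreathRight, wreathLeft, Pi.mulSingle_apply, inv_mul_eq_one, eq_comm]
  · simp [baseHom, wreathRight, wreathLeft]

theorem baseHom_mem_range_freeToWreath (f : finitelySupported fun _ : H => G) :
    restrictedWreath.baseHom G H f ∈ (freeToWreath G H).range := by
  classical
  let K : Subgroup (H → G) :=
    ((freeToWreath G H).range.comap (restrictedWreath.baseHom G H)).map (Subgroup.subtype _)
  have mulSingle_mem (h : H) (g : G) : Pi.mulSingle h g ∈ K :=
    ⟨⟨_, mulSingle_mem_finitelySupported (G := fun _ => G) h g⟩,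
      ⟨.inr h * .inl g * (.inr h)⁻¹, by simp [restrictedWreath.baseHom_mulSingle]⟩, rfl⟩
  obtain ⟨f', hf', heq⟩ : (f : H → G) ∈ K :=
    Submonoid.pi_mem_of_mulSingle_mem_aux (Set.Finite.toFinset f.2) _
      (fun h hh => not_not.1 (mt (Set.Finite.mem_toFinset f.2).2 hh)) fun h _ => mulSingle_mem h _
  obtain rfl : f' = f := Subtype.ext heq
  exact hf'

theorem freeToWreath_surjective (G H : Type*) [Group G] [Group H] :
    Function.Surjective (freeToWreath G H) := by
  intro w
  obtain ⟨z, hz⟩ := baseHom_mem_range_freeToWreath ⟨w.1.left, w.2⟩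
  refine ⟨z * .inr w.1.right, ?_⟩
  rw [map_mul, hz, freeToWreath_inr]
  ext <;> simp [restrictedWreath.baseHom, wreathRight]

end Wreath

section OrderedGroups

variable {A B C D : Type*} [Group A] [Group B] [Group C] [Group D] {P : Submonoid A}
  {Q : Submonoid B} {R : Submonoid C} {S : Submonoid D}

theorem mem_coneIcc_one {g p : A} : g ∈ coneIcc P 1 p ↔ g ∈ P ∧ g⁻¹ * p ∈ P := by
  simp [coneIcc, ConeLE]

namespace IsPositiveCone

theorem eq_one_of_mul_eq_one (hP : IsPositiveCone P) {x y : A} (hx : x ∈ P) (hy : y ∈ P)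
    (h : x * y = 1) : x = 1 ∧ y = 1 := by
  obtain rfl : x = 1 := hP x hx (by rwa [inv_eq_of_mul_eq_one_right h])
  exact ⟨rfl, by simpa using h⟩

theorem closure (hQ : IsPositiveCone Q) {s : Set A} (φ : A →* B) (hφ : ∀ x ∈ s, φ x ∈ Q)
    (hs : ∀ x ∈ s, φ x = 1 → x = 1) : IsPositiveCone (Submonoid.closure s) := by
  have map_mem {x : A} (hx : x ∈ Submonoid.closure s) : φ x ∈ Q :=
    Submonoid.closure_le (S := Q.comap φ) |>.2 hφ hx
  have eq_one_of_map_eq_one {x : A} (hx : x ∈ Submonoid.closure s) : φ x = 1 → x = 1 := by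
    induction hx using Submonoid.closure_induction with
    | mem x hx => exact hs x hx
    | one => exact fun _ => rfl
    | mul x y hx hy ihx ihy =>
      intro h
      obtain ⟨hx1, hy1⟩ := hQ.eq_one_of_mul_eq_one (map_mem hx) (map_mem hy) (by rwa [← map_mul])
      rw [ihx hx1, ihy hy1, one_mul]
  intro x hx hx'
  exact eq_one_of_map_eq_one hx (hQ _ (map_mem hx) (by simpa using map_mem hx'))

theorem of_isOrderHom (hQ : IsPositiveCone Q) {φ : A →* B} (hφ : IsOrderHom P Q φ)
    (h : ∀ p ∈ P, φ p = 1 → p = 1) : IsPositiveCone P := by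
  simpa using hQ.closure φ hφ h

theorem prod (hP : IsPositiveCone P) (hQ : IsPositiveCone Q) : IsPositiveCone (P.prod Q) :=
  fun _ hx hx' => Prod.ext (hP _ hx.1 hx'.1) (hQ _ hx.2 hx'.2)

theorem pi {ι : Type*} {G : ι → Type*} [∀ i, Group (G i)] {P : ∀ i, Submonoid (G i)}
    (hP : ∀ i, IsPositiveCone (P i)) : IsPositiveCone (Submonoid.pi Set.univ P) :=
  fun _ hx hx' => funext fun i => hP i _ (hx i trivial) (hx' i trivial)

theorem freeProductCone (hP : IsPositiveCone P) (hQ : IsPositiveCone Q) :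
    IsPositiveCone (freeProductCone P Q) := by
  rw [_root_.freeProductCone, Submonoid.sup_eq_closure]
  refine (hP.prod hQ).closure Monoid.Coprod.toProd ?_ ?_
  · rintro _ (⟨p, hp, rfl⟩ | ⟨q, hq, rfl⟩)
    · exact ⟨by simpa using hp, by simp [one_mem]⟩
    · exact ⟨by simp [one_mem], by simpa using hq⟩
  · rintro _ (⟨p, -, rfl⟩ | ⟨q, -, rfl⟩) h
    · simp_all
    · simp_all

theorem freeProductConeI {ι : Type*} {G : ι → Type*} [∀ i, Group (G i)]
    {P : ∀ i, Submonoid (G i)} (hP : ∀ i, IsPositiveCone (P i)) :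
    IsPositiveCone (freeProductConeI P) := by
  classical
  rw [_root_.freeProductConeI, Submonoid.iSup_eq_closure]
  refine (IsPositiveCone.pi hP).closure (Monoid.CoprodI.lift (MonoidHom.mulSingle G)) ?_ ?_
  · simp only [Set.mem_iUnion]
    rintro _ ⟨i, p, hp, rfl⟩
    rw [Monoid.CoprodI.lift_of]
    exact (Submonoid.mulSingle_mem_pi (I := Set.univ) i p).2 fun _ => hp
  · simp only [Set.mem_iUnion]
    rintro _ ⟨i, p, -, rfl⟩ h
    simp_all

end IsPositiveCone

namespace IsReduction

variable {φ : A →* B}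

theorem eq_one (h : IsReduction P Q φ) {p : A} (hp : p ∈ P) (hp1 : φ p = 1) : p = 1 :=
  (h.2 p hp).injOn (mem_coneIcc_one.2 ⟨hp, by simp [one_mem]⟩)
    (mem_coneIcc_one.2 ⟨one_mem _, by simpa using hp⟩) (by simpa using hp1)

theorem isPositiveCone (h : IsReduction P Q φ) (hQ : IsPositiveCone Q) : IsPositiveCone P :=
  hQ.of_isOrderHom h.1 fun _ => h.eq_one

theorem of_injOn_surjOn (h : IsOrderHom P Q φ) (hinj : ∀ p ∈ P, Set.InjOn φ (coneIcc P 1 p))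
    (hsurj : ∀ p ∈ P, Set.SurjOn φ (coneIcc P 1 p) (coneIcc Q 1 (φ p))) : IsReduction P Q φ := by
  refine ⟨h, fun p hp => ⟨fun g hg => ?_, hinj p hp, hsurj p hp⟩⟩
  rw [mem_coneIcc_one] at hg ⊢
  exact ⟨h _ hg.1, by simpa using h _ hg.2⟩

theorem comp {φ : A →* B} {ψ : B →* C} (hψ : IsReduction Q R ψ) (hφ : IsReduction P Q φ) :
    IsReduction P R (ψ.comp φ) :=
  ⟨fun p hp => hψ.1 _ (hφ.1 p hp), fun p hp => (hψ.2 _ (hφ.1 p hp)).comp (hφ.2 p hp)⟩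

end IsReduction

namespace IsStrongReduction

theorem id (P : Submonoid A) : IsStrongReduction P P (MonoidHom.id A) :=
  ⟨fun _ hp => hp, Set.bijOn_id _⟩

theorem of_injOn {φ : A →* B} (h : Set.InjOn φ P) : IsStrongReduction P (P.map φ) φ :=
  ⟨fun _ hp => Submonoid.mem_map_of_mem φ hp, h.bijOn_image⟩

theorem comp {φ : A →* B} {ψ : B →* C} (hψ : IsStrongReduction Q R ψ)
    (hφ : IsStrongReduction P Q φ) : IsStrongReduction P R (ψ.comp φ) :=
  ⟨fun p hp => hψ.1 _ (hφ.1 p hp), hψ.2.comp hφ.2⟩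

theorem map_eq {φ : A →* B} (h : IsStrongReduction P Q φ) : P.map φ = Q :=
  SetLike.coe_injective h.2.image_eq

theorem isReduction {φ : A →* B} (h : IsStrongReduction P Q φ) : IsReduction P Q φ := by
  refine .of_injOn_surjOn h.1 (fun p _ => h.2.injOn.mono fun g hg => (mem_coneIcc_one.1 hg).1)
    fun p hp q hq => ?_
  rw [mem_coneIcc_one] at hq
  obtain ⟨a, ha, rfl⟩ := h.2.surjOn hq.1
  obtain ⟨b, hb, hab⟩ := h.2.surjOn hq.2
  obtain rfl : a * b = p := h.2.injOn (mul_mem ha hb) hp (by simp [hab])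
  exact ⟨a, mem_coneIcc_one.2 ⟨ha, by simpa using hb⟩, rfl⟩

theorem isPositiveCone_iff {φ : A →* B} (h : IsStrongReduction P Q φ) :
    IsPositiveCone P ↔ IsPositiveCone Q := by
  refine ⟨fun hP q hq hq' => ?_, h.isReduction.isPositiveCone⟩
  obtain ⟨a, ha, rfl⟩ := h.2.surjOn hq
  obtain ⟨b, hb, hab⟩ := h.2.surjOn hq'
  have hone : a * b = 1 := h.2.injOn (mul_mem ha hb) (one_mem P) (by simp [hab])
  rw [(hP.eq_one_of_mul_eq_one ha hb hone).1, map_one]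

end IsStrongReduction

section Products

theorem coneIcc_prod (P : Submonoid A) (Q : Submonoid B) (p : A × B) :
    coneIcc (P.prod Q) 1 p = coneIcc P 1 p.1 ×ˢ coneIcc Q 1 p.2 := by
  ext g
  exact and_and_and_comm

theorem IsReduction.prodMap {φ : A →* C} {ψ : B →* D} (hφ : IsReduction P R φ)
    (hψ : IsReduction Q S ψ) : IsReduction (P.prod Q) (R.prod S) (φ.prodMap ψ) := by
  refine ⟨fun p hp => ⟨hφ.1 _ hp.1, hψ.1 _ hp.2⟩, fun p hp => ?_⟩
  rw [coneIcc_prod, coneIcc_prod]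
  exact (hφ.2 _ hp.1).prodMap (hψ.2 _ hp.2)

theorem IsStrongReduction.prodMap {φ : A →* C} {ψ : B →* D} (hφ : IsStrongReduction P R φ)
    (hψ : IsStrongReduction Q S ψ) : IsStrongReduction (P.prod Q) (R.prod S) (φ.prodMap ψ) :=
  ⟨fun _ hp => ⟨hφ.1 _ hp.1, hψ.1 _ hp.2⟩, hφ.2.prodMap hψ.2⟩

variable {ι : Type*} {G H : ι → Type*} [∀ i, Group (G i)] [∀ i, Group (H i)]
  {P : ∀ i, Submonoid (G i)} {Q : ∀ i, Submonoid (H i)} {φ : ∀ i, G i →* H i}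

theorem coneIcc_pi (P : ∀ i, Submonoid (G i)) (p : ∀ i, G i) :
    coneIcc (Submonoid.pi Set.univ P) 1 p = Set.univ.pi fun i => coneIcc (P i) 1 (p i) := by
  ext g
  simp [mem_coneIcc_one, Submonoid.mem_pi, Set.mem_pi, forall_and]

theorem bijOn_piMap_univ_pi {X Y : ι → Type*} {f : ∀ i, X i → Y i} {s : ∀ i, Set (X i)}
    {t : ∀ i, Set (Y i)} (h : ∀ i, Set.BijOn (f i) (s i) (t i)) :
    Set.BijOn (Pi.map f) (Set.univ.pi s) (Set.univ.pi t) := by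
  have hinj : Set.InjOn (Pi.map f) (Set.univ.pi s) := fun x hx y hy hxy =>
    funext fun i => (h i).injOn (hx i trivial) (hy i trivial) (congrFun hxy i)
  have himage : Pi.map f '' Set.univ.pi s = Set.univ.pi t := by
    simp only [Set.piMap_image_univ_pi, (h _).image_eq]
  exact himage ▸ hinj.bijOn_image

theorem IsReduction.piMap (h : ∀ i, IsReduction (P i) (Q i) (φ i)) :
    IsReduction (Submonoid.pi Set.univ P) (Submonoid.pi Set.univ Q) (MonoidHom.piMap φ) := by
  refine ⟨fun p hp i _ => (h i).1 _ (hp i trivial), fun p hp => ?_⟩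
  rw [coneIcc_pi, coneIcc_pi]
  exact bijOn_piMap_univ_pi fun i => (h i).2 _ (hp i trivial)

theorem IsStrongReduction.piMap (h : ∀ i, IsStrongReduction (P i) (Q i) (φ i)) :
    IsStrongReduction (Submonoid.pi Set.univ P) (Submonoid.pi Set.univ Q) (MonoidHom.piMap φ) := by
  refine ⟨fun p hp i _ => (h i).1 _ (hp i trivial), ?_⟩
  rw [Submonoid.coe_pi, Submonoid.coe_pi]
  exact bijOn_piMap_univ_pi fun i => (h i).2

end Products

namespace IsHereditarySubgroup

variable {H : Subgroup A} {T : Submonoid H}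

theorem isOrderHom (h : IsHereditarySubgroup P H T) : IsOrderHom T P H.subtype :=
  fun q hq => h.1 ⟨q, hq, rfl⟩

theorem isReduction (h : IsHereditarySubgroup P H T) : IsReduction T P H.subtype := by
  refine .of_injOn_surjOn h.isOrderHom (fun q _ => H.subtype_injective.injOn) fun q hq g hg => ?_
  rw [mem_coneIcc_one] at hg
  obtain ⟨⟨a, ha, rfl⟩, ⟨b, hb, hab⟩⟩ := h.2 _ hg.1 _ hg.2 (by simpa using hq)
  obtain rfl : b = a⁻¹ * q := Subtype.ext hab
  exact ⟨a, mem_coneIcc_one.2 ⟨ha, hb⟩, rfl⟩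

end IsHereditarySubgroup

end OrderedGroups

section Words

variable {A B C D : Type*} [Group A] [Group B] [Group C] [Group D] {P : Submonoid A}
  {Q : Submonoid B} {R : Submonoid C} {S : Submonoid D}

/-- The element `a₁ * b₁ * ⋯ * aₙ * bₙ` of the free product that is spelled by the list of the
pairs `(aᵢ, bᵢ)`. -/
def wordProd (L : List (A × B)) : Monoid.Coprod A B :=
  (L.map fun z => .inl z.1 * .inr z.2).prod

@[simp]
theorem wordProd_nil : wordProd ([] : List (A × B)) = 1 := rfl

@[simp]
theorem wordProd_cons (z : A × B) (L : List (A × B)) :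
    wordProd (z :: L) = .inl z.1 * .inr z.2 * wordProd L := by
  simp [wordProd]

@[simp]
theorem wordProd_append (L L' : List (A × B)) :
    wordProd (L ++ L') = wordProd L * wordProd L' := by
  simp [wordProd]

theorem map_wordProd (φ : A →* C) (ψ : B →* D) (L : List (A × B)) :
    Monoid.Coprod.map φ ψ (wordProd L) = wordProd (L.map (Prod.map φ ψ)) := by
  simp [wordProd, map_list_prod, Function.comp_def]

theorem inl_mem_freeProductCone {p : A} (hp : p ∈ P) : .inl p ∈ freeProductCone P Q :=
  Submonoid.mem_sup_left (Submonoid.mem_map_of_mem _ hp)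

theorem inr_mem_freeProductCone {q : B} (hq : q ∈ Q) : .inr q ∈ freeProductCone P Q :=
  Submonoid.mem_sup_right (Submonoid.mem_map_of_mem _ hq)

theorem wordProd_mem {L : List (A × B)} (hL : ∀ z ∈ L, z ∈ P.prod Q) :
    wordProd L ∈ freeProductCone P Q := by
  refine Submonoid.list_prod_mem _ fun g hg => ?_
  obtain ⟨z, hz, rfl⟩ := List.mem_map.1 hg
  exact mul_mem (inl_mem_freeProductCone (hL z hz).1) (inr_mem_freeProductCone (hL z hz).2)

/-- A nonempty list of pairs in `P × Q` is a reduced word if it spells `a₁ * b₁ * ⋯ * aₙ * bₙ` with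
all letters except possibly `a₁` and `bₙ` nontrivial. For positive cones, every element of `P * Q`
has exactly one such spelling; that of `1` is `[(1, 1)]`. -/
structure IsReducedWord (P : Submonoid A) (Q : Submonoid B) (L : List (A × B)) : Prop where
  ne_nil : L ≠ []
  mem : ∀ z ∈ L, z ∈ P.prod Q
  isChain : L.IsChain fun z z' => z.2 ≠ 1 ∧ z'.1 ≠ 1

/-- The word `M` is an initial part of the word `L`, cut off inside a pair `(p, q)` of `L`: its last
pair is `(x, 1)` with `1 ≤ x ≤ p`, or `(p, y)` with `1 ≤ y ≤ q`. -/
def IsInitialPart (P : Submonoid A) (Q : Submonoid B) (M L : List (A × B)) : Prop :=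
  ∃ K C x y p q, M = K ++ [(x, y)] ∧ L = K ++ (p, q) :: C ∧
    x ∈ coneIcc P 1 p ∧ y ∈ coneIcc Q 1 q ∧ (y = 1 ∨ x = p)

namespace IsReducedWord

variable {K L L' M N : List (A × B)} {z z' : A × B} {x : A} {y : B}

theorem singleton (hz : z ∈ P.prod Q) : IsReducedWord P Q [z] :=
  ⟨by simp, by simpa using hz, by simp⟩

theorem cons (hz : z ∈ P.prod Q) (hz2 : z.2 ≠ 1) (hz1 : z'.1 ≠ 1)
    (h : IsReducedWord P Q (z' :: L)) : IsReducedWord P Q (z :: z' :: L) :=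
  ⟨by simp, List.forall_mem_cons.2 ⟨hz, h.mem⟩, List.isChain_cons_cons.2 ⟨⟨hz2, hz1⟩, h.isChain⟩⟩

theorem tail (h : IsReducedWord P Q (z :: L)) (hL : L ≠ []) : IsReducedWord P Q L :=
  ⟨hL, (List.forall_mem_cons.1 h.mem).2, h.isChain.tail⟩

theorem append_cons_iff :
    IsReducedWord P Q (K ++ z :: L) ↔
      IsReducedWord P Q (K ++ [z]) ∧ IsReducedWord P Q (z :: L) := by
  refine ⟨fun h => ?_, fun ⟨hK, hL⟩ => ⟨by simp, ?_, List.isChain_split.2 ⟨hK.isChain, hL.isChain⟩⟩⟩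
  · obtain ⟨hK, hL⟩ := List.isChain_split.1 h.isChain
    exact ⟨⟨by simp, fun w hw => h.mem w (by grind), hK⟩,
      ⟨by simp, fun w hw => h.mem w (List.mem_append_right K hw), hL⟩⟩
  · exact List.forall_mem_append.2 ⟨fun w hw => hK.mem w (List.mem_append_left _ hw), hL.mem⟩

theorem replace_last (h : IsReducedWord P Q (K ++ [z])) (hz' : z' ∈ P.prod Q)
    (hne : z.1 ≠ 1 → z'.1 ≠ 1) : IsReducedWord P Q (K ++ [z']) := by
  obtain ⟨hchain, -, hlast⟩ := List.isChain_append.1 h.isChain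
  refine ⟨by simp, ?_, List.isChain_append.2 ⟨hchain, .singleton _, fun w hw w' hw' => ?_⟩⟩
  · exact List.forall_mem_append.2
      ⟨fun w hw => h.mem w (List.mem_append_left _ hw), by simpa using hz'⟩
  · obtain rfl : z' = w' := by simpa using hw'
    exact (hlast w hw z rfl).imp_right hne

theorem replace_head (h : IsReducedWord P Q (z :: L)) (hz' : z' ∈ P.prod Q)
    (hne : z.2 ≠ 1 → z'.2 ≠ 1) : IsReducedWord P Q (z' :: L) := by
  obtain ⟨hhead, hchain⟩ := List.isChain_cons.1 h.isChain
  exact ⟨by simp, List.forall_mem_cons.2 ⟨hz', (List.forall_mem_cons.1 h.mem).2⟩,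
    List.isChain_cons.2 ⟨fun w hw => (hhead w hw).imp_left hne, hchain⟩⟩

theorem exists_eq_append (h : IsReducedWord P Q L) : ∃ K z, L = K ++ [z] :=
  ⟨_, _, (List.dropLast_append_getLast h.ne_nil).symm⟩

theorem exists_mul (hP : IsPositiveCone P) (hQ : IsPositiveCone Q) (hM : IsReducedWord P Q M)
    (hN : IsReducedWord P Q N) :
    ∃ L, IsReducedWord P Q L ∧ IsInitialPart P Q M L ∧ wordProd L = wordProd M * wordProd N := by
  obtain ⟨K, ⟨x, y⟩, rfl⟩ := hM.exists_eq_append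
  obtain ⟨⟨s, t⟩, N, rfl⟩ := List.exists_cons_of_ne_nil hN.ne_nil
  have ⟨hx, hy⟩ : (x, y) ∈ P.prod Q := hM.mem _ (by simp)
  have ⟨hs, ht⟩ : (s, t) ∈ P.prod Q := hN.mem _ (by simp)
  suffices ∃ p q C, IsReducedWord P Q (K ++ (p, q) :: C) ∧
      (x ∈ coneIcc P 1 p ∧ y ∈ coneIcc Q 1 q ∧ (y = 1 ∨ x = p)) ∧
      wordProd (K ++ (p, q) :: C) = wordProd (K ++ [(x, y)]) * wordProd ((s, t) :: N) by
    obtain ⟨p, q, C, hred, hinit, hprod⟩ := this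
    exact ⟨_, hred, ⟨K, C, x, y, p, q, rfl, rfl, hinit⟩, hprod⟩
  simp only [mem_coneIcc_one]
  obtain rfl | hy1 := eq_or_ne y 1
  · have hxs : (x * s, t) ∈ P.prod Q := ⟨mul_mem hx hs, ht⟩
    refine ⟨x * s, t, N, append_cons_iff.2
      ⟨hM.replace_last hxs fun hx1 h => ?_, hN.replace_head hxs fun h => h⟩,
      ⟨⟨hx, by simpa using hs⟩, ⟨one_mem Q, by simpa using ht⟩, .inl rfl⟩, by simp [mul_assoc]⟩
    exact hx1 (hP.eq_one_of_mul_eq_one hx hs h).1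
  obtain rfl | hs1 := eq_or_ne s 1
  · have hyt : (x, y * t) ∈ P.prod Q := ⟨hx, mul_mem hy ht⟩
    refine ⟨x, y * t, N, append_cons_iff.2
      ⟨hM.replace_last hyt fun h => h, hN.replace_head hyt fun _ h => ?_⟩,
      ⟨⟨hx, by simp [one_mem]⟩, ⟨hy, by simpa using ht⟩, .inr rfl⟩, by simp [mul_assoc]⟩
    exact hy1 (hQ.eq_one_of_mul_eq_one hy ht h).1
  · exact ⟨x, y, (s, t) :: N, append_cons_iff.2 ⟨hM, hN.cons ⟨hx, hy⟩ hy1 hs1⟩,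
      ⟨⟨hx, by simp [one_mem]⟩, ⟨hy, by simp [one_mem]⟩, .inr rfl⟩, by simp [mul_assoc]⟩

theorem map {φ : A →* C} {ψ : B →* D} (hφ : IsReduction P R φ) (hψ : IsReduction Q S ψ)
    (h : IsReducedWord P Q L) : IsReducedWord R S (L.map (Prod.map φ ψ)) := by
  refine ⟨by simpa using h.ne_nil, ?_, ?_⟩
  · simp only [List.forall_mem_map]
    exact fun z hz => ⟨hφ.1 _ (h.mem z hz).1, hψ.1 _ (h.mem z hz).2⟩
  · rw [List.isChain_map]
    exact h.isChain.imp_of_mem_imp fun z z' hz hz' hne =>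
      ⟨mt (hψ.eq_one (h.mem z hz).2) hne.1, mt (hφ.eq_one (h.mem z' hz').1) hne.2⟩

end IsReducedWord

theorem exists_isReducedWord (hP : IsPositiveCone P) (hQ : IsPositiveCone Q)
    {g : Monoid.Coprod A B} (hg : g ∈ freeProductCone P Q) :
    ∃ L, IsReducedWord P Q L ∧ wordProd L = g := by
  rw [freeProductCone, Submonoid.sup_eq_closure] at hg
  induction hg using Submonoid.closure_induction with
  | mem g hg =>
    obtain ⟨p, hp, rfl⟩ | ⟨q, hq, rfl⟩ := hg
    · exact ⟨[(p, 1)], .singleton ⟨hp, one_mem Q⟩, by simp⟩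
    · exact ⟨[(1, q)], .singleton ⟨one_mem P, hq⟩, by simp⟩
  | one => exact ⟨[(1, 1)], .singleton (one_mem _), by simp⟩
  | mul g g' _ _ ih ih' =>
    obtain ⟨M, hM, rfl⟩ := ih
    obtain ⟨N, hN, rfl⟩ := ih'
    obtain ⟨L, hL, -, hprod⟩ := hM.exists_mul hP hQ hN
    exact ⟨L, hL, hprod⟩

section Uniqueness

theorem mem_of_left_ne_one_of_mem_wreathCone {w : restrictedWreath A B} (hw : w ∈ wreathCone P Q)
    {c : B} (hc : w.1.left c ≠ 1) : c ∈ Q := by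
  rw [wreathCone, Submonoid.sup_eq_closure] at hw
  induction hw using Submonoid.closure_induction_left generalizing c with
  | one => simp at hc
  | mul_left v hv w _ ih =>
    obtain ⟨p, -, rfl⟩ | ⟨q, hq, rfl⟩ := hv
    · obtain rfl | hc1 := eq_or_ne c 1
      · exact one_mem Q
      · rw [wreathLeft_mul_left_of_ne p w hc1] at hc
        exact ih hc
    · rw [wreathRight_mul_left] at hc
      simpa using mul_mem hq (ih hc)

theorem map_freeToWreath_freeProductCone (P : Submonoid A) (Q : Submonoid B) :
    (freeProductCone P Q).map (freeToWreath A B) = wreathCone P Q := by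
  rw [freeProductCone, wreathCone, Submonoid.map_sup, Submonoid.map_map, Submonoid.map_map]
  rfl

theorem freeToWreath_wordProd_cons (x : A) (y : B) (L : List (A × B)) :
    freeToWreath A B (wordProd ((x, y) :: L)) =
      wreathLeft A B x * (wreathRight A B y * freeToWreath A B (wordProd L)) := by
  simp only [wordProd_cons, map_mul, freeToWreath_inl, freeToWreath_inr, mul_assoc]

theorem freeToWreath_wordProd_mem {L : List (A × B)} (h : ∀ z ∈ L, z ∈ P.prod Q) :
    freeToWreath A B (wordProd L) ∈ wreathCone P Q := by
  rw [← map_freeToWreath_freeProductCone]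
  exact Submonoid.mem_map_of_mem _ (wordProd_mem h)

namespace IsReducedWord

variable {L L' : List (A × B)} {x : A} {y : B}

theorem freeToWreath_left_one (hQ : IsPositiveCone Q) (h : IsReducedWord P Q ((x, y) :: L)) :
    (freeToWreath A B (wordProd ((x, y) :: L))).1.left 1 = x := by
  obtain ⟨⟨-, hy⟩, hL⟩ := List.forall_mem_cons.1 h.mem
  suffices (freeToWreath A B (wordProd L)).1.left y⁻¹ = 1 by
    rw [freeToWreath_wordProd_cons, wreathLeft_mul_left_one, wreathRight_mul_left, mul_one, this,
      mul_one]
  by_contra hne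
  -- The factors after `x` are supported in `y * Q`, which contains `1` only if `y = 1`.
  obtain rfl : y = 1 :=
    hQ y hy (mem_of_left_ne_one_of_mem_wreathCone (freeToWreath_wordProd_mem hL) hne)
  obtain _ | ⟨z, L⟩ := L
  · simp at hne
  · exact (List.isChain_cons_cons.1 h.isChain).1.1 rfl

theorem wreathRight_mul_freeToWreath_left_ne_one (hQ : IsPositiveCone Q)
    (h : IsReducedWord P Q ((x, y) :: L)) (hL : L ≠ []) :
    (wreathRight A B y * freeToWreath A B (wordProd L)).1.left y ≠ 1 := by
  obtain ⟨⟨x', y'⟩, L, rfl⟩ := List.exists_cons_of_ne_nil hL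
  rw [wreathRight_mul_left, inv_mul_cancel, (h.tail hL).freeToWreath_left_one hQ]
  exact (List.isChain_cons_cons.1 h.isChain).1.2

theorem inv_mul_mem_of_wreathRight_mul_eq (hQ : IsPositiveCone Q)
    (h : IsReducedWord P Q ((x, y) :: L)) (hL : L ≠ []) {y' : B} {w : restrictedWreath A B}
    (hw : w ∈ wreathCone P Q)
    (heq : wreathRight A B y * freeToWreath A B (wordProd L) = wreathRight A B y' * w) :
    y'⁻¹ * y ∈ Q := by
  refine mem_of_left_ne_one_of_mem_wreathCone hw ?_
  rw [← wreathRight_mul_left, ← heq]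
  exact h.wreathRight_mul_freeToWreath_left_ne_one hQ hL

theorem eq_of_freeToWreath_eq (hQ : IsPositiveCone Q) (h : IsReducedWord P Q L)
    (h' : IsReducedWord P Q L')
    (heq : freeToWreath A B (wordProd L) = freeToWreath A B (wordProd L')) : L = L' := by
  induction L generalizing L' with
  | nil => exact absurd rfl h.ne_nil
  | cons z L ih =>
    obtain ⟨x, y⟩ := z
    obtain ⟨⟨x', y'⟩, L', rfl⟩ := List.exists_cons_of_ne_nil h'.ne_nil
    obtain rfl : x = x' := by
      rw [← h.freeToWreath_left_one hQ, heq, h'.freeToWreath_left_one hQ]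
    have htail : wreathRight A B y * freeToWreath A B (wordProd L) =
        wreathRight A B y' * freeToWreath A B (wordProd L') := by
      simpa only [freeToWreath_wordProd_cons, mul_right_inj] using heq
    obtain rfl | hne := eq_or_ne L []
    · obtain rfl : L' = [] := by
        by_contra hne'
        apply h'.wreathRight_mul_freeToWreath_left_ne_one hQ hne'
        rw [← htail]
        simp [wreathRight]
      obtain rfl : y = y' := by simpa [wreathRight] using congrArg (fun w => w.1.right) htail
      rfl
    · have hne' : L' ≠ [] := by
        rintro rfl
        apply h.wreathRight_mul_freeToWreath_left_ne_one hQ hne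
        rw [htail]
        simp [wreathRight]
      have hmem := freeToWreath_wordProd_mem (List.forall_mem_cons.1 h.mem).2
      have hmem' := freeToWreath_wordProd_mem (List.forall_mem_cons.1 h'.mem).2
      have hy : y'⁻¹ * y ∈ Q := h.inv_mul_mem_of_wreathRight_mul_eq hQ hne hmem' htail
      have hy' : y⁻¹ * y' ∈ Q := h'.inv_mul_mem_of_wreathRight_mul_eq hQ hne' hmem htail.symm
      obtain rfl : y' = y := inv_mul_eq_one.1 (hQ _ hy (by simpa using hy'))
      rw [ih (h.tail hne) (h'.tail hne') (mul_left_cancel htail)]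

theorem eq_of_wordProd_eq (hQ : IsPositiveCone Q) (h : IsReducedWord P Q L)
    (h' : IsReducedWord P Q L') (heq : wordProd L = wordProd L') : L = L' :=
  h.eq_of_freeToWreath_eq hQ h' (congrArg _ heq)

end IsReducedWord

theorem isStrongReduction_freeToWreath (hP : IsPositiveCone P) (hQ : IsPositiveCone Q) :
    IsStrongReduction (freeProductCone P Q) (wreathCone P Q) (freeToWreath A B) := by
  rw [← map_freeToWreath_freeProductCone]
  refine .of_injOn fun g hg g' hg' heq => ?_
  obtain ⟨L, hL, rfl⟩ := exists_isReducedWord hP hQ hg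
  obtain ⟨L', hL', rfl⟩ := exists_isReducedWord hP hQ hg'
  rw [hL.eq_of_freeToWreath_eq hQ hL' heq]

theorem IsPositiveCone.wreathCone (hP : IsPositiveCone P) (hQ : IsPositiveCone Q) :
    IsPositiveCone (wreathCone P Q) :=
  (isStrongReduction_freeToWreath hP hQ).isPositiveCone_iff.1 (hP.freeProductCone hQ)

end Uniqueness

section Functoriality

variable {φ : A →* C} {ψ : B →* D} {L M : List (A × B)}

theorem map_freeProductCone (P : Submonoid A) (Q : Submonoid B) (φ : A →* C) (ψ : B →* D) :
    (freeProductCone P Q).map (Monoid.Coprod.map φ ψ) = freeProductCone (P.map φ) (Q.map ψ) := by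
  rw [freeProductCone, freeProductCone, Submonoid.map_sup, Submonoid.map_map, Submonoid.map_map,
    Submonoid.map_map, Submonoid.map_map]
  rfl

theorem IsOrderHom.coprodMap (hφ : IsOrderHom P R φ) (hψ : IsOrderHom Q S ψ) :
    IsOrderHom (freeProductCone P Q) (freeProductCone R S) (Monoid.Coprod.map φ ψ) := by
  have hle : (freeProductCone P Q).map (Monoid.Coprod.map φ ψ) ≤ freeProductCone R S := by
    rw [map_freeProductCone]
    exact sup_le_sup (Submonoid.monotone_map (Submonoid.map_le_iff_le_comap.2 hφ))
      (Submonoid.monotone_map (Submonoid.map_le_iff_le_comap.2 hψ))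
  exact fun g hg => hle (Submonoid.mem_map_of_mem _ hg)

namespace IsInitialPart

theorem wordProd_mem_coneIcc (h : IsInitialPart P Q M L) (hL : ∀ z ∈ L, z ∈ P.prod Q) :
    wordProd M ∈ coneIcc (freeProductCone P Q) 1 (wordProd L) := by
  obtain ⟨K, C, x, y, p, q, rfl, rfl, hx, hy, hxy⟩ := h
  rw [mem_coneIcc_one] at hx hy ⊢
  obtain ⟨hK, hC⟩ := List.forall_mem_append.1 hL
  constructor
  · exact wordProd_mem (List.forall_mem_append.2 ⟨hK, by simpa using ⟨hx.1, hy.1⟩⟩)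
  · have hquot : (wordProd (K ++ [(x, y)]))⁻¹ * wordProd (K ++ (p, q) :: C) =
        wordProd ((x⁻¹ * p, y⁻¹ * q) :: C) := by
      obtain rfl | rfl := hxy <;> simp [mul_assoc]
    rw [hquot]
    exact wordProd_mem (List.forall_mem_cons.2 ⟨⟨hx.2, hy.2⟩, (List.forall_mem_cons.1 hC).2⟩)

theorem eq_of_map_eq (hφ : IsReduction P R φ) (hψ : IsReduction Q S ψ)
    (hL : ∀ z ∈ L, z ∈ P.prod Q) (hM : IsInitialPart P Q M L) {M' : List (A × B)}
    (hM' : IsInitialPart P Q M' L)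
    (heq : M.map (Prod.map φ ψ) = M'.map (Prod.map φ ψ)) : M = M' := by
  obtain ⟨K, C, x, y, p, q, rfl, rfl, hx, hy, -⟩ := hM
  obtain ⟨K', C', x', y', p', q', rfl, hcut, hx', hy', -⟩ := hM'
  have hlen : K.length = K'.length := by simpa using congrArg List.length heq
  obtain ⟨rfl, hcut⟩ := List.append_inj hcut hlen
  obtain ⟨⟨rfl, rfl⟩, rfl⟩ : (p = p' ∧ q = q') ∧ C = C' := by simpa using hcut
  obtain ⟨hφx, hψy⟩ : φ x = φ x' ∧ ψ y = ψ y' := by simpa using heq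
  have ⟨hp, hq⟩ : (p, q) ∈ P.prod Q := hL _ (by simp)
  rw [(hφ.2 p hp).injOn hx hx' hφx, (hψ.2 q hq).injOn hy hy' hψy]

theorem exists_of_map (hφ : IsReduction P R φ) (hψ : IsReduction Q S ψ)
    (hL : ∀ z ∈ L, z ∈ P.prod Q) {N : List (C × D)}
    (hN : IsInitialPart R S N (L.map (Prod.map φ ψ))) :
    ∃ M, IsInitialPart P Q M L ∧ M.map (Prod.map φ ψ) = N := by
  obtain ⟨K, T, r, s, _, _, rfl, hcut, hr, hs, hrs⟩ := hN
  obtain ⟨K, T, rfl, rfl, hT⟩ := List.map_eq_append_iff.1 hcut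
  obtain ⟨⟨p, q⟩, T, rfl, hpq, rfl⟩ := List.map_eq_cons_iff.1 hT
  obtain ⟨rfl, rfl⟩ := Prod.mk.inj hpq
  have ⟨hp, hq⟩ : (p, q) ∈ P.prod Q := hL _ (by simp)
  obtain ⟨x, hx, rfl⟩ := (hφ.2 p hp).surjOn hr
  obtain ⟨y, hy, rfl⟩ := (hψ.2 q hq).surjOn hs
  have hpp : p ∈ coneIcc P 1 p := mem_coneIcc_one.2 ⟨hp, by simp [one_mem]⟩
  have hxy : y = 1 ∨ x = p :=
    hrs.imp (hψ.eq_one (mem_coneIcc_one.1 hy).1) ((hφ.2 p hp).injOn hx hpp)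
  exact ⟨K ++ [(x, y)], ⟨K, T, x, y, p, q, rfl, rfl, hx, hy, hxy⟩, by simp⟩

end IsInitialPart

theorem IsReducedWord.mem_coneIcc_iff (hP : IsPositiveCone P) (hQ : IsPositiveCone Q)
    (hL : IsReducedWord P Q L) {g : Monoid.Coprod A B} :
    g ∈ coneIcc (freeProductCone P Q) 1 (wordProd L) ↔
      ∃ M, IsReducedWord P Q M ∧ IsInitialPart P Q M L ∧ wordProd M = g := by
  constructor
  · intro hg
    obtain ⟨hg, hg'⟩ := mem_coneIcc_one.1 hg
    obtain ⟨M, hM, rfl⟩ := exists_isReducedWord hP hQ hg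
    obtain ⟨N, hN, hprodN⟩ := exists_isReducedWord hP hQ hg'
    obtain ⟨L', hL', hinit, hprod⟩ := hM.exists_mul hP hQ hN
    obtain rfl : L' = L := hL'.eq_of_wordProd_eq hQ hL (by rw [hprod, hprodN, mul_inv_cancel_left])
    exact ⟨M, hM, hinit, rfl⟩
  · rintro ⟨M, -, hinit, rfl⟩
    exact hinit.wordProd_mem_coneIcc hL.mem

theorem IsReduction.coprodMap (hR : IsPositiveCone R) (hS : IsPositiveCone S)
    (hφ : IsReduction P R φ) (hψ : IsReduction Q S ψ) :
    IsReduction (freeProductCone P Q) (freeProductCone R S) (Monoid.Coprod.map φ ψ) := by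
  have hP := hφ.isPositiveCone hR
  have hQ := hψ.isPositiveCone hS
  refine .of_injOn_surjOn (hφ.1.coprodMap hψ.1) (fun p hp g hg g' hg' heq => ?_)
    fun p hp w hw => ?_ <;> obtain ⟨L, hL, rfl⟩ := exists_isReducedWord hP hQ hp
  · obtain ⟨M, hM, hML, rfl⟩ := (hL.mem_coneIcc_iff hP hQ).1 hg
    obtain ⟨M', hM', hML', rfl⟩ := (hL.mem_coneIcc_iff hP hQ).1 hg'
    rw [map_wordProd, map_wordProd] at heq
    have hmap := (hM.map hφ hψ).eq_of_wordProd_eq hS (hM'.map hφ hψ) heq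
    rw [hML.eq_of_map_eq hφ hψ hL.mem hML' hmap]
  · rw [map_wordProd, (hL.map hφ hψ).mem_coneIcc_iff hR hS] at hw
    obtain ⟨N, -, hNL, rfl⟩ := hw
    obtain ⟨M, hML, rfl⟩ := hNL.exists_of_map hφ hψ hL.mem
    exact ⟨wordProd M, hML.wordProd_mem_coneIcc hL.mem, map_wordProd φ ψ M⟩

theorem injOn_list_map {X Y : Type*} {f : X → Y} {s : Set X} (hf : s.InjOn f) :
    {L : List X | ∀ x ∈ L, x ∈ s}.InjOn (List.map f) := by
  intro L hL L' hL' heq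
  induction L generalizing L' with
  | nil => exact (List.map_eq_nil_iff.1 heq.symm).symm
  | cons x L ih =>
    obtain ⟨x', L', rfl, hx, hLL'⟩ := List.map_eq_cons_iff.1 heq.symm
    obtain ⟨hxs, hL⟩ := List.forall_mem_cons.1 hL
    obtain ⟨hxs', hL'⟩ := List.forall_mem_cons.1 hL'
    rw [hf hxs hxs' hx.symm, ih hL hL' hLL'.symm]

theorem IsStrongReduction.coprodMap (hR : IsPositiveCone R) (hS : IsPositiveCone S)
    (hφ : IsStrongReduction P R φ) (hψ : IsStrongReduction Q S ψ) :
    IsStrongReduction (freeProductCone P Q) (freeProductCone R S) (Monoid.Coprod.map φ ψ) := by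
  have hP := hφ.isReduction.isPositiveCone hR
  have hQ := hψ.isReduction.isPositiveCone hS
  rw [← hφ.map_eq, ← hψ.map_eq, ← map_freeProductCone]
  refine .of_injOn fun g hg g' hg' heq => ?_
  obtain ⟨L, hL, rfl⟩ := exists_isReducedWord hP hQ hg
  obtain ⟨L', hL', rfl⟩ := exists_isReducedWord hP hQ hg'
  rw [map_wordProd, map_wordProd] at heq
  have hmap := (hL.map hφ.isReduction hψ.isReduction).eq_of_wordProd_eq hS
    (hL'.map hφ.isReduction hψ.isReduction) heq
  rw [injOn_list_map (hφ.2.injOn.prodMap hψ.2.injOn) hL.mem hL'.mem hmap]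

theorem IsReduction.freeToWreath_comp_coprodMap (hR : IsPositiveCone R) (hS : IsPositiveCone S)
    (hφ : IsReduction P R φ) (hψ : IsReduction Q S ψ) :
    IsReduction (freeProductCone P Q) (wreathCone R S)
      ((freeToWreath C D).comp (Monoid.Coprod.map φ ψ)) :=
  (isStrongReduction_freeToWreath hR hS).isReduction.comp (hφ.coprodMap hR hS hψ)

theorem IsStrongReduction.freeToWreath_comp_coprodMap (hR : IsPositiveCone R)
    (hS : IsPositiveCone S) (hφ : IsStrongReduction P R φ) (hψ : IsStrongReduction Q S ψ) :
    IsStrongReduction (freeProductCone P Q) (wreathCone R S)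
      ((freeToWreath C D).comp (Monoid.Coprod.map φ ψ)) :=
  (isStrongReduction_freeToWreath hR hS).comp (hφ.coprodMap hR hS hψ)

end Functoriality

end Words

section FiniteFreeProducts

open Monoid

open Classical in
/-- The canonical homomorphism `*ᵢ G i → G a * (*_{i ≠ a} G i)`, which reduces finite free products
to binary ones by induction on the number of factors. -/
noncomputable def splitOff {ι : Type*} (G : ι → Type*) [∀ i, Group (G i)] (a : ι) :
    CoprodI G →* Coprod (G a) (CoprodI fun i : {i // i ≠ a} => G i) :=
  CoprodI.lift fun i =>
    if h : i = a then h ▸ Coprod.inl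
    else Coprod.inr.comp (CoprodI.of (M := fun i : {i // i ≠ a} => G i) (i := ⟨i, h⟩))

theorem splitOff_comp_of_self {ι : Type*} (G : ι → Type*) [∀ i, Group (G i)] (a : ι) :
    (splitOff G a).comp CoprodI.of = Coprod.inl := by
  rw [splitOff, CoprodI.lift_comp_of, dif_pos rfl]

theorem splitOff_comp_of_of_ne {ι : Type*} (G : ι → Type*) [∀ i, Group (G i)] {a i : ι}
    (h : i ≠ a) : (splitOff G a).comp CoprodI.of =
      Coprod.inr.comp (CoprodI.of (M := fun i : {i // i ≠ a} => G i) (i := ⟨i, h⟩)) := by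
  rw [splitOff, CoprodI.lift_comp_of, dif_neg h]

theorem splitOff_injective {ι : Type*} (G : ι → Type*) [∀ i, Group (G i)] (a : ι) :
    Function.Injective (splitOff G a) := by
  let merge : Coprod (G a) (CoprodI fun i : {i // i ≠ a} => G i) →* CoprodI G :=
    Coprod.lift CoprodI.of (CoprodI.lift fun _ => CoprodI.of)
  have hmerge : merge.comp (splitOff G a) = MonoidHom.id (CoprodI G) := by
    refine CoprodI.ext_hom _ _ fun i => ?_
    rw [MonoidHom.comp_assoc]
    obtain rfl | h := eq_or_ne i a
    · rw [splitOff_comp_of_self, Coprod.lift_comp_inl, MonoidHom.id_comp]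
    · rw [splitOff_comp_of_of_ne G h, ← MonoidHom.comp_assoc, Coprod.lift_comp_inr,
        CoprodI.lift_comp_of, MonoidHom.id_comp]
  exact Function.LeftInverse.injective (DFunLike.congr_fun hmerge)

theorem isStrongReduction_splitOff {ι : Type*} {G : ι → Type*} [∀ i, Group (G i)]
    (P : ∀ i, Submonoid (G i)) (a : ι) :
    IsStrongReduction (freeProductConeI P)
      (freeProductCone (P a) (freeProductConeI fun i : {i // i ≠ a} => P i)) (splitOff G a) := by
  have hmap : (freeProductConeI P).map (splitOff G a) =
      freeProductCone (P a) (freeProductConeI fun i : {i // i ≠ a} => P i) := by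
    simp only [freeProductCone, freeProductConeI, Submonoid.map_iSup, Submonoid.map_map]
    rw [iSup_split_single _ a, splitOff_comp_of_self, iSup_subtype]
    congr! 6 with i h
    exact splitOff_comp_of_of_ne G h
  rw [← hmap]
  exact .of_injOn (splitOff_injective G a).injOn

theorem subsingleton_coprodI {ι : Type*} [IsEmpty ι] (G : ι → Type*) [∀ i, Group (G i)] :
    Subsingleton (CoprodI G) := by
  have hid : MonoidHom.id (CoprodI G) = 1 := CoprodI.ext_hom _ _ isEmptyElim
  exact subsingleton_of_forall_eq 1 (DFunLike.congr_fun hid)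

theorem freeProductConeI_induction {p : ∀ {G : Type u} [Group G], Submonoid G → Prop}
    (subsingleton : ∀ {G : Type u} [Group G] [Subsingleton G] (P : Submonoid G), p P)
    (freeProductCone : ∀ {G H : Type u} [Group G] [Group H] {P : Submonoid G} {Q : Submonoid H},
      p P → p Q → p (freeProductCone P Q))
    (of_isStrongReduction : ∀ {G H : Type u} [Group G] [Group H] {P : Submonoid G}
      {Q : Submonoid H} {φ : G →* H}, IsStrongReduction P Q φ → p Q → p P)
    {ι : Type} [Finite ι] {G : ι → Type u} [∀ i, Group (G i)] {P : ∀ i, Submonoid (G i)}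
    (hP : ∀ i, p (P i)) : p (freeProductConeI P) := by
  induction hn : Nat.card ι using Nat.strong_induction_on generalizing ι with
  | h n ih =>
    obtain _ | ⟨⟨a⟩⟩ := isEmpty_or_nonempty ι
    · have := subsingleton_coprodI G
      exact subsingleton _
    · have hcard : Nat.card {i // i ≠ a} < n := hn ▸ Finite.card_subtype_lt (not_not.2 rfl)
      exact of_isStrongReduction (isStrongReduction_splitOff P a)
        (freeProductCone (hP a) (ih _ hcard (fun i => hP i) rfl))

end FiniteFreeProducts

section Classes

variable {G H : Type u} [Group G] [Group H] {P : Submonoid G} {Q : Submonoid H}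

theorem StronglyReducesToAmenable.of_isAmenable (hP : IsPositiveCone P) (hG : IsAmenable G) :
    StronglyReducesToAmenable P :=
  ⟨G, _, P, MonoidHom.id G, hG, hP, .id P⟩

theorem StronglyReducesToAmenable.reducesToAmenable :
    StronglyReducesToAmenable P → ReducesToAmenable P
  | ⟨K, _, R, φ, hK, hR, hφ⟩ => ⟨K, _, R, φ, hK, hR, hφ.isReduction⟩

theorem StronglyReducesToAmenable.of_subsingleton [Subsingleton G] (P : Submonoid G) :
    StronglyReducesToAmenable P :=
  .of_isAmenable (fun _ _ _ => Subsingleton.elim _ _) .of_subsingleton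

namespace ReducesToAmenable

theorem of_isReduction {φ : G →* H} (hφ : IsReduction P Q φ) :
    ReducesToAmenable Q → ReducesToAmenable P
  | ⟨K, _, R, ψ, hK, hR, hψ⟩ => ⟨K, _, R, ψ.comp φ, hK, hR, hψ.comp hφ⟩

theorem prod : ReducesToAmenable P → ReducesToAmenable Q → ReducesToAmenable (P.prod Q)
  | ⟨K, _, R, φ, hK, hR, hφ⟩, ⟨L, _, S, ψ, hL, hS, hψ⟩ =>
    ⟨K × L, _, R.prod S, φ.prodMap ψ, hK.prod hL, hR.prod hS, hφ.prodMap hψ⟩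

theorem pi {ι : Type} [Finite ι] {G : ι → Type u} [∀ i, Group (G i)]
    {P : ∀ i, Submonoid (G i)} (h : ∀ i, ReducesToAmenable (P i)) :
    ReducesToAmenable (Submonoid.pi Set.univ P) := by
  choose K _ Q φ hK hQ hφ using h
  exact ⟨∀ i, K i, _, Submonoid.pi Set.univ Q, .piMap φ, .pi hK, .pi hQ, .piMap hφ⟩

theorem freeProductCone :
    ReducesToAmenable P → ReducesToAmenable Q → ReducesToAmenable (freeProductCone P Q)
  | ⟨K, _, R, φ, hK, hR, hφ⟩, ⟨L, _, S, ψ, hL, hS, hψ⟩ =>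
    ⟨restrictedWreath K L, _, wreathCone R S, (freeToWreath K L).comp (Monoid.Coprod.map φ ψ),
      hK.restrictedWreath hL, hR.wreathCone hS, hφ.freeToWreath_comp_coprodMap hR hS hψ⟩

theorem freeProductConeI {ι : Type} [Finite ι] {G : ι → Type u} [∀ i, Group (G i)]
    {P : ∀ i, Submonoid (G i)} :
    (∀ i, ReducesToAmenable (P i)) → ReducesToAmenable (freeProductConeI P) :=
  freeProductConeI_induction
    (fun P => (StronglyReducesToAmenable.of_subsingleton P).reducesToAmenable) freeProductCone
    fun hφ => of_isReduction hφ.isReduction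

end ReducesToAmenable

namespace StronglyReducesToAmenable

theorem of_isStrongReduction {φ : G →* H} (hφ : IsStrongReduction P Q φ) :
    StronglyReducesToAmenable Q → StronglyReducesToAmenable P
  | ⟨K, _, R, ψ, hK, hR, hψ⟩ => ⟨K, _, R, ψ.comp φ, hK, hR, hψ.comp hφ⟩

theorem prod : StronglyReducesToAmenable P → StronglyReducesToAmenable Q →
    StronglyReducesToAmenable (P.prod Q)
  | ⟨K, _, R, φ, hK, hR, hφ⟩, ⟨L, _, S, ψ, hL, hS, hψ⟩ =>
    ⟨K × L, _, R.prod S, φ.prodMap ψ, hK.prod hL, hR.prod hS, hφ.prodMap hψ⟩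

theorem pi {ι : Type} [Finite ι] {G : ι → Type u} [∀ i, Group (G i)]
    {P : ∀ i, Submonoid (G i)} (h : ∀ i, StronglyReducesToAmenable (P i)) :
    StronglyReducesToAmenable (Submonoid.pi Set.univ P) := by
  choose K _ Q φ hK hQ hφ using h
  exact ⟨∀ i, K i, _, Submonoid.pi Set.univ Q, .piMap φ, .pi hK, .pi hQ, .piMap hφ⟩

theorem freeProductCone : StronglyReducesToAmenable P → StronglyReducesToAmenable Q →
    StronglyReducesToAmenable (freeProductCone P Q)
  | ⟨K, _, R, φ, hK, hR, hφ⟩, ⟨L, _, S, ψ, hL, hS, hψ⟩ =>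
    ⟨restrictedWreath K L, _, wreathCone R S, (freeToWreath K L).comp (Monoid.Coprod.map φ ψ),
      hK.restrictedWreath hL, hR.wreathCone hS, hφ.freeToWreath_comp_coprodMap hR hS hψ⟩

theorem freeProductConeI {ι : Type} [Finite ι] {G : ι → Type u} [∀ i, Group (G i)]
    {P : ∀ i, Submonoid (G i)} :
    (∀ i, StronglyReducesToAmenable (P i)) → StronglyReducesToAmenable (freeProductConeI P) :=
  freeProductConeI_induction of_subsingleton freeProductCone of_isStrongReduction

end StronglyReducesToAmenable

namespace IsHereditarySubgroup

variable {K : Subgroup G} {R : Submonoid K}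

theorem reducesToAmenable (h : IsHereditarySubgroup P K R) :
    ReducesToAmenable P → ReducesToAmenable R :=
  .of_isReduction h.isReduction

theorem stronglyReducesToAmenable (h : IsHereditarySubgroup P K R) :
    StronglyReducesToAmenable P → StronglyReducesToAmenable R
  | ⟨L, _, S, φ, hL, hS, hφ⟩ => by
    have hφK : IsStrongReduction R (R.map (φ.comp K.subtype)) (φ.comp K.subtype) :=
      .of_injOn (hφ.2.injOn.comp K.subtype_injective.injOn h.isOrderHom)
    have hR : IsPositiveCone R := h.isReduction.isPositiveCone (hφ.isReduction.isPositiveCone hS)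
    exact ⟨L, _, _, _, hL, hφK.isPositiveCone_iff.1 hR, hφK⟩

end IsHereditarySubgroup

end Classes

theorem mainTheorem2 :
    -- amenable ordered groups belong to both classes
    (∀ (G : Type u) [Group G] (P : Submonoid G), IsPositiveCone P → IsAmenable G →
      ReducesToAmenable P ∧ StronglyReducesToAmenable P) ∧
    -- hereditary subgroups
    (∀ (G : Type u) [Group G] (P : Submonoid G) (H : Subgroup G) (Q : Submonoid H),
      IsPositiveCone P → IsHereditarySubgroup P H Q →
        IsPositiveCone Q ∧
        (ReducesToAmenable P → ReducesToAmenable Q) ∧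
        (StronglyReducesToAmenable P → StronglyReducesToAmenable Q)) ∧
    -- direct products of two ordered groups
    (∀ (G₁ G₂ : Type u) [Group G₁] [Group G₂] (P₁ : Submonoid G₁) (P₂ : Submonoid G₂),
      IsPositiveCone P₁ → IsPositiveCone P₂ →
        IsPositiveCone (P₁.prod P₂) ∧
        (ReducesToAmenable P₁ → ReducesToAmenable P₂ → ReducesToAmenable (P₁.prod P₂)) ∧
        (StronglyReducesToAmenable P₁ → StronglyReducesToAmenable P₂ →
          StronglyReducesToAmenable (P₁.prod P₂))) ∧
    -- direct products of finite families
    (∀ (ι : Type) [Finite ι] (G : ι → Type u) [∀ i, Group (G i)] (P : ∀ i, Submonoid (G i)),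
      (∀ i, IsPositiveCone (P i)) →
        IsPositiveCone (Submonoid.pi Set.univ P) ∧
        ((∀ i, ReducesToAmenable (P i)) → ReducesToAmenable (Submonoid.pi Set.univ P)) ∧
        ((∀ i, StronglyReducesToAmenable (P i)) →
          StronglyReducesToAmenable (Submonoid.pi Set.univ P))) ∧
    -- free products of two ordered groups
    (∀ (G₁ G₂ : Type u) [Group G₁] [Group G₂] (P₁ : Submonoid G₁) (P₂ : Submonoid G₂),
      IsPositiveCone P₁ → IsPositiveCone P₂ →
        IsPositiveCone (freeProductCone P₁ P₂) ∧
        (ReducesToAmenable P₁ → ReducesToAmenable P₂ →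
          ReducesToAmenable (freeProductCone P₁ P₂)) ∧
        (StronglyReducesToAmenable P₁ → StronglyReducesToAmenable P₂ →
          StronglyReducesToAmenable (freeProductCone P₁ P₂))) ∧
    -- free products of finite families
    (∀ (ι : Type) [Finite ι] (G : ι → Type u) [∀ i, Group (G i)] (P : ∀ i, Submonoid (G i)),
      (∀ i, IsPositiveCone (P i)) →
        IsPositiveCone (freeProductConeI P) ∧
        ((∀ i, ReducesToAmenable (P i)) → ReducesToAmenable (freeProductConeI P)) ∧
        ((∀ i, StronglyReducesToAmenable (P i)) →
          StronglyReducesToAmenable (freeProductConeI P))) ∧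
    -- the natural map from the free product onto the wreath product is a strong reduction, and
    -- the wreath product of amenable groups is amenable
    (∀ (G₁ G₂ : Type u) [Group G₁] [Group G₂] (P₁ : Submonoid G₁) (P₂ : Submonoid G₂),
      IsPositiveCone P₁ → IsPositiveCone P₂ →
        IsPositiveCone (wreathCone P₁ P₂) ∧
        Function.Surjective (freeToWreath G₁ G₂) ∧
        IsStrongReduction (freeProductCone P₁ P₂) (wreathCone P₁ P₂) (freeToWreath G₁ G₂) ∧
        (IsAmenable G₁ → IsAmenable G₂ → IsAmenable (restrictedWreath G₁ G₂))) ∧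
    -- (strong) reductions of the factors induce one of the free product to the wreath product
    (∀ (G₁ G₂ H₁ H₂ : Type u) [Group G₁] [Group G₂] [Group H₁] [Group H₂]
      (P₁ : Submonoid G₁) (P₂ : Submonoid G₂) (Q₁ : Submonoid H₁) (Q₂ : Submonoid H₂)
      (φ₁ : G₁ →* H₁) (φ₂ : G₂ →* H₂),
      IsPositiveCone P₁ → IsPositiveCone P₂ → IsPositiveCone Q₁ → IsPositiveCone Q₂ →
        (IsReduction P₁ Q₁ φ₁ → IsReduction P₂ Q₂ φ₂ →
          IsReduction (freeProductCone P₁ P₂) (wreathCone Q₁ Q₂)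
            ((freeToWreath H₁ H₂).comp (Monoid.Coprod.map φ₁ φ₂))) ∧
        (IsStrongReduction P₁ Q₁ φ₁ → IsStrongReduction P₂ Q₂ φ₂ →
          IsStrongReduction (freeProductCone P₁ P₂) (wreathCone Q₁ Q₂)
            ((freeToWreath H₁ H₂).comp (Monoid.Coprod.map φ₁ φ₂)))) := by
  refine ⟨fun G _ P hP hG => ?_, fun G _ P H Q hP h => ?_, fun G₁ G₂ _ _ P₁ P₂ h₁ h₂ => ?_,
    fun ι _ G _ P h => ?_, fun G₁ G₂ _ _ P₁ P₂ h₁ h₂ => ?_, fun ι _ G _ P h => ?_,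
    fun G₁ G₂ _ _ P₁ P₂ h₁ h₂ => ?_, fun G₁ G₂ H₁ H₂ _ _ _ _ P₁ P₂ Q₁ Q₂ φ₁ φ₂ _ _ h₁ h₂ => ?_⟩
  · have hstrong := StronglyReducesToAmenable.of_isAmenable hP hG
    exact ⟨hstrong.reducesToAmenable, hstrong⟩
  · exact ⟨h.isReduction.isPositiveCone hP, h.reducesToAmenable, h.stronglyReducesToAmenable⟩
  · exact ⟨h₁.prod h₂, .prod, .prod⟩
  · exact ⟨.pi h, .pi, .pi⟩
  · exact ⟨h₁.freeProductCone h₂, .freeProductCone, .freeProductCone⟩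
  · exact ⟨.freeProductConeI h, .freeProductConeI, .freeProductConeI⟩
  · exact ⟨h₁.wreathCone h₂, freeToWreath_surjective G₁ G₂, isStrongReduction_freeToWreath h₁ h₂,
      IsAmenable.restrictedWreath⟩
  · exact ⟨fun hφ hψ => hφ.freeToWreath_comp_coprodMap h₁ h₂ hψ,
      fun hφ hψ => hφ.freeToWreath_comp_coprodMap h₁ h₂ hψ⟩
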